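/- Let $\tau>0$. On $\mathbb R^4$ put $\langle v,w\rangle=v_1w_1+v_2w_2-v_3w_3-v_4w_4$ and identify $\mathrm{SL}(2,\mathbb R)$ with $\{v\in\mathbb R^4:\langle v,v\rangle=1\}=\{(z,w)\in\mathbb C^2:|z|^2-|w|^2=1\}$. Let $X_1(z,w)=(iz,iw)$, $X_2(z,w)=(i\bar w,i\bar z)$, $X_3(z,w)=(\bar w,\bar z)$, and equip $\mathrm{SL}(2,\mathbb R)$ with the Riemannian metric $g_\tau(X,Y)=-\langle X,Y\rangle+(1+\tau^2)\langle X,X_1\rangle\langle Y,X_1\rangle$, for which $E_1=-\tau^{-1}X_1$, $E_2=X_2$, $E_3=X_3$ is an orthonormal frame. Let $\nabla$ be its Levi-Civita connection and $R(X,Y)Z=\nabla_X\nabla_YZ-\nabla_Y\nabla_XZ-\nabla_{[X,Y]}Z$. Let $I\subset\mathbb R$ be an open interval and $\gamma:I\to(\mathrm{SL}(2,\mathbb R),g_\tau)$ a smooth curve parametrized by arc length, with $T=\gamma'$, which is proper biharmonic, i.e. $\nabla_T^3T-R(T,\nabla_TT)T=0$ on $I$ and $\nabla_TT\not\equiv0$.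 Then there are $\vartheta\in(0,\pi)$ and a smooth $\beta:I\to\mathbb R$ with $$\gamma'=\cos\vartheta\,E_1+\sin\vartheta\sin\beta\,E_2+\sin\vartheta\cos\beta\,E_3 ,$$ and for all such $\vartheta,\beta$ the derivative $b:=\beta'$ is constant. Put $$a=\tfrac12\big(-\tau^{-2}+1-(1+\tau^{-2})\cos2\vartheta\big)-\tau^{-1}b\cos\vartheta .$$ If $b^2<4a$, then: 1. if $\vartheta\le\pi/2$, then $b=-\tau^{-1}(2+\tau^2)\cos\vartheta+\sqrt{(4+5\tau^2)\cos^2\vartheta-4(1+\tau^2)}$ (and if $\vartheta>\pi/2$, i.e. for the curves obtained from these by reversing the parameter, the same holds with $-\sqrt{\cdots}$ in place of $+\sqrt{\cdots}$); 2. $\displaystyle\frac{(2+\tau^2)^2}{4+5\tau^2+\tau^4}<\cos^2\vartheta<1$; 3. with $\mu=\tfrac12\sqrt{4a-b^2}$ and $w_{14}=\dfrac{b\tau+2\cos\vartheta}{2\tau\mu}$ there is a matrix $A\in\mathrm O_2(4)$ commuting with $J_1$ such that for all $s\in I$ $$\begin{aligned}\gamma(s)=A\Big(&\cos(\tfrac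 b2s)\cosh(\mu s)+w_{14}\sin(\tfrac b2s)\sinh(\mu s),\ \sin(\tfrac b2s)\cosh(\mu s)-w_{14}\cos(\tfrac b2s)\sinh(\mu s),\\&\cos(\tfrac b2s)\sinh(\mu s)\sqrt{1+w_{14}^2},\ \sin(\tfrac b2s)\sinh(\mu s)\sqrt{1+w_{14}^2}\Big).\end{aligned}$$ Here $J_1(z,w)=(iz,iw)$, and $\mathrm O_2(4)=\{A\in\mathrm{GL}(4,\mathbb R):A^t=\epsilon A^{-1}\epsilon\}$ with $\epsilon=\mathrm{diag}(1,1,-1,-1)$. -/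

import Mathlib

open scoped Matrix ContDiff

namespace SL2Tau

noncomputable section

/-- The scalar product of signature `(2, 2)` on `ℝ⁴`. -/
def ip (v w : Fin 4 → ℝ) : ℝ := v 0 * w 0 + v 1 * w 1 - v 2 * w 2 - v 3 * w 3

/-- `SL(2, ℝ)`, realised as the quadric `⟨v, v⟩ = 1` of `ℝ⁴₂`. With `z = v₀ + i v₁` and
`w = v₂ + i v₃` this is `|z|² - |w|² = 1`. -/
def quadric : Set (Fin 4 → ℝ) := {v | ip v v = 1}

/-- The Hopf vector field `X₁(z, w) = (i z, i w)`. -/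
def X₁ (p : Fin 4 → ℝ) : Fin 4 → ℝ := ![-p 1, p 0, -p 3, p 2]

/-- `X₂(z, w) = (i w̄, i z̄)`. -/
def X₂ (p : Fin 4 → ℝ) : Fin 4 → ℝ := ![p 3, p 2, p 1, p 0]

/-- `X₃(z, w) = (w̄, z̄)`. -/
def X₃ (p : Fin 4 → ℝ) : Fin 4 → ℝ := ![p 2, -p 3, p 0, -p 1]

/-- The metric `g_τ` at the point `p`, evaluated on `u` and `v`
(meaningful for `p` on the quadric and `u`, `v` tangent to it at `p`). -/
def metric (τ : ℝ) (p u v : Fin 4 → ℝ) : ℝ :=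
  -ip u v + (1 + τ ^ 2) * ip u (X₁ p) * ip v (X₁ p)

/-- The `g_τ`-orthonormal frame `E₁ = -τ⁻¹ X₁`, `E₂ = X₂`, `E₃ = X₃`
(the indices are `0`, `1`, `2`). -/
def frame (τ : ℝ) (i : Fin 3) (p : Fin 4 → ℝ) : Fin 4 → ℝ :=
  ![(-τ⁻¹) • X₁ p, X₂ p, X₃ p] i

/-- The `i`-th frame component of the tangent vector `v` at `p`. -/
def comp (τ : ℝ) (p v : Fin 4 → ℝ) (i : Fin 3) : ℝ := metric τ p v (frame τ i p)

/-- The function `g_τ([Eᵢ, Eⱼ], Eₖ)`. -/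
def structureFun (τ : ℝ) (i j k : Fin 3) (p : Fin 4 → ℝ) : ℝ :=
  comp τ p (VectorField.lieBracket ℝ (frame τ i) (frame τ j) p) k

/-- The connection coefficient `g_τ(∇_{Eᵢ} Eⱼ, Eₖ)` of the Levi-Civita connection of `g_τ`,
given by Koszul's formula in the orthonormal frame. -/
def connCoeff (τ : ℝ) (i j k : Fin 3) (p : Fin 4 → ℝ) : ℝ :=
  (structureFun τ i j k p - structureFun τ j k i p + structureFun τ k i j p) / 2

/-- The Levi-Civita covariant derivative `∇_X Y` of vector fields. -/
def cov (τ : ℝ) (X Y : (Fin 4 → ℝ) → (Fin 4 → ℝ)) (p : Fin 4 → ℝ) : Fin 4 → ℝ :=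
  ∑ k : Fin 3, (fderiv ℝ (fun q => comp τ q (Y q) k) p (X p) +
    ∑ i : Fin 3, ∑ j : Fin 3,
      connCoeff τ i j k p * comp τ p (X p) i * comp τ p (Y p) j) • frame τ k p

/-- `R(X, Y) Z = ∇_X ∇_Y Z - ∇_Y ∇_X Z - ∇_{[X, Y]} Z` for vector fields. -/
def curvField (τ : ℝ) (X Y Z : (Fin 4 → ℝ) → (Fin 4 → ℝ)) (p : Fin 4 → ℝ) : Fin 4 → ℝ :=
  cov τ X (cov τ Y Z) p - cov τ Y (cov τ X Z) p - cov τ (VectorField.lieBracket ℝ X Y) Z p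

/-- The vector field with constant frame components whose value at `p` is the tangent
vector `u`. -/
def extend (τ : ℝ) (p u : Fin 4 → ℝ) (q : Fin 4 → ℝ) : Fin 4 → ℝ :=
  ∑ i : Fin 3, comp τ p u i • frame τ i q

/-- The curvature tensor `R(u, v) w` of `g_τ` for tangent vectors at `p`; the curvature being
tensorial, it is computed on any fields extending the vectors. -/
def curv (τ : ℝ) (p u v w : Fin 4 → ℝ) : Fin 4 → ℝ :=
  curvField τ (extend τ p u) (extend τ p v) (extend τ p w) p

/-- The Levi-Civita covariant derivative `∇_{γ'} V` of a vector field `V` along the curve `γ`. -/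
def covAlong (τ : ℝ) (γ V : ℝ → Fin 4 → ℝ) (s : ℝ) : Fin 4 → ℝ :=
  ∑ k : Fin 3, (deriv (fun t => comp τ (γ t) (V t) k) s +
    ∑ i : Fin 3, ∑ j : Fin 3,
      connCoeff τ i j k (γ s) * comp τ (γ s) (deriv γ s) i * comp τ (γ s) (V s) j) •
        frame τ k (γ s)

/-- The tension field `∇_{γ'} γ'` of the curve `γ`. -/
def tension (τ : ℝ) (γ : ℝ → Fin 4 → ℝ) : ℝ → Fin 4 → ℝ := covAlong τ γ (deriv γ)

/-- The bitension field `∇_{γ'} ∇_{γ'} (tension) - R(γ', tension) γ'` of the curve `γ`. -/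
def bitension (τ : ℝ) (γ : ℝ → Fin 4 → ℝ) (s : ℝ) : Fin 4 → ℝ :=
  covAlong τ γ (covAlong τ γ (tension τ γ)) s -
    curv τ (γ s) (deriv γ s) (tension τ γ s) (deriv γ s)

/-- On the open interval `I`, `γ` is a smooth curve in `(SL(2, ℝ), g_τ)` parametrized by
arc length. -/
structure IsArcLengthCurve (τ : ℝ) (I : Set ℝ) (γ : ℝ → Fin 4 → ℝ) : Prop where
  smooth : ContDiffOn ℝ ∞ γ I
  mem_quadric : ∀ s ∈ I, γ s ∈ quadric
  unit_speed : ∀ s ∈ I, metric τ (γ s) (deriv γ s) (deriv γ s) = 1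

/-- Proper biharmonic curve: the bitension field vanishes, but the curve is not a geodesic. -/
structure IsProperBiharmonic (τ : ℝ) (I : Set ℝ) (γ : ℝ → Fin 4 → ℝ) : Prop where
  biharmonic : ∀ s ∈ I, bitension τ γ s = 0
  not_geodesic : ¬ ∀ s ∈ I, tension τ γ s = 0

/-- `ϑ` is the (constant) angle between `γ'` and `E₁`, and `β` is a smooth angular function of
the horizontal part of `γ'`:
`γ' = cos ϑ E₁ + sin ϑ sin β E₂ + sin ϑ cos β E₃` on `I`. -/
structure HasAngles (τ : ℝ) (I : Set ℝ) (γ : ℝ → Fin 4 → ℝ) (ϑ : ℝ) (β : ℝ → ℝ) : Prop where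
  smooth : ContDiffOn ℝ ∞ β I
  tangent : ∀ s ∈ I, deriv γ s =
    Real.cos ϑ • frame τ 0 (γ s) + (Real.sin ϑ * Real.sin (β s)) • frame τ 1 (γ s) +
      (Real.sin ϑ * Real.cos (β s)) • frame τ 2 (γ s)

/-- The constant `a`, in terms of `τ`, `ϑ` and `b = β'`. -/
def aConst (τ ϑ b : ℝ) : ℝ :=
  1 / 2 * (-(τ ^ 2)⁻¹ + 1 - (1 + (τ ^ 2)⁻¹) * Real.cos (2 * ϑ)) - τ⁻¹ * Real.cos ϑ * b

/-- `μ = √(4a - b²) / 2`. -/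
def muConst (τ ϑ b : ℝ) : ℝ := Real.sqrt (4 * aConst τ ϑ b - b ^ 2) / 2

/-- `w₁₄ = (b τ + 2 cos ϑ) / (2 τ μ)`. -/
def wConst (τ ϑ b : ℝ) : ℝ := (b * τ + 2 * Real.cos ϑ) / (2 * τ * muConst τ ϑ b)

/-- The model curve
`(cos(bs/2) cosh(μs) + w sin(bs/2) sinh(μs), sin(bs/2) cosh(μs) - w cos(bs/2) sinh(μs),
cos(bs/2) sinh(μs) √(1+w²), sin(bs/2) sinh(μs) √(1+w²))`. -/
def modelCurve (b μ w s : ℝ) : Fin 4 → ℝ :=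
  ![Real.cos (b / 2 * s) * Real.cosh (μ * s) + w * Real.sin (b / 2 * s) * Real.sinh (μ * s),
    Real.sin (b / 2 * s) * Real.cosh (μ * s) - w * Real.cos (b / 2 * s) * Real.sinh (μ * s),
    Real.cos (b / 2 * s) * Real.sinh (μ * s) * Real.sqrt (1 + w ^ 2),
    Real.sin (b / 2 * s) * Real.sinh (μ * s) * Real.sqrt (1 + w ^ 2)]

/-- `ε = diag(1, 1, -1, -1)`. -/
def epsMat : Matrix (Fin 4) (Fin 4) ℝ := Matrix.diagonal ![1, 1, -1, -1]

/-- The complex structure `J₁` of `ℝ⁴`. -/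
def J₁ : Matrix (Fin 4) (Fin 4) ℝ :=
  !![0, -1, 0, 0; 1, 0, 0, 0; 0, 0, 0, -1; 0, 0, 1, 0]

/-- The indefinite orthogonal group `O₂(4) = {A ∈ GL(4, ℝ) : Aᵗ = ε A⁻¹ ε}`. -/
def O₂4 : Set (Matrix (Fin 4) (Fin 4) ℝ) :=
  {A | IsUnit A ∧ Aᵀ = epsMat * A⁻¹ * epsMat}

end

end SL2Tau

/-! In the frame `E₁, E₂, E₃` all brackets have constant coefficients, so the connection and the
curvature along the curve are algebraic in frame components. The sectional curvature is `τ²` on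
planes containing `E₁` and `-(4 + 3τ²)` on the plane of `E₂, E₃`.

Write `∇_T T = κN` and let `B` be the binormal. Biharmonicity makes `κ` constant and gives `κ² +
torsion² = τ² - 4(1 + τ²)B₁²` and `torsion' = -4(1 + τ²)N₁B₁`, where the index 1 denotes the `E₁`
component. Together with `B₁' = (τ - torsion)N₁` these force `N₁ = 0` (`normal_component_eq_zero`).
Hence `⟨T, E₁⟩ = c = cos ϑ` is constant and the rest of `T` rotates with constant speed `b`. The
curvature relation becomes a quadratic equation for `x = b + (2τ⁻¹ + 2τ)c` (`biharmonic_system`).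

The condition `b² < 4a` reads `(x - 2τc)² < 4(1 - c²)`. It selects one root of the quadratic and
gives the lower bound on `cos² ϑ` (`root_eq_of_nonneg`).

For the explicit form, the rotated curve `G = e^{-ibs/2} γ` satisfies `G'' = μ²G`, so it is a
combination of `cosh (μs)` and `sinh (μs)` with constant vector coefficients. Orthonormalising these
over `J₁` yields the matrix `A` (`exists_congruence`). -/

namespace SL2Tau

noncomputable section

/-! ### The frame and its structure constants -/

/-- The frame field `Eᵢ` as a linear endomorphism of `ℝ⁴`. -/
def frameLin (τ : ℝ) (i : Fin 3) : (Fin 4 → ℝ) →ₗ[ℝ] (Fin 4 → ℝ) where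
  toFun := frame τ i
  map_add' x y := by
    fin_cases i <;> ext k <;> fin_cases k <;> simp [frame, X₁, X₂, X₃] <;> ring
  map_smul' c x := by
    fin_cases i <;> ext k <;> fin_cases k <;> simp [frame, X₁, X₂, X₃] <;> ring

@[simp] lemma frameLin_apply (τ : ℝ) (i : Fin 3) (p : Fin 4 → ℝ) :
    frameLin τ i p = frame τ i p := rfl

/-- The Lie bracket of two linear vector fields is the commutator. -/
lemma lieBracket_linear (A B : (Fin 4 → ℝ) →ₗ[ℝ] (Fin 4 → ℝ)) (p : Fin 4 → ℝ) :
    VectorField.lieBracket ℝ (fun q => A q) (fun q => B q) p = B (A p) - A (B p) := by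
  have hA : fderiv ℝ (fun q => A q) p = A.toContinuousLinearMap :=
    A.toContinuousLinearMap.hasFDerivAt.fderiv
  have hB : fderiv ℝ (fun q => B q) p = B.toContinuousLinearMap :=
    B.toContinuousLinearMap.hasFDerivAt.fderiv
  simp [VectorField.lieBracket, hA, hB]

/-- The structure constants of the frame: `[Eᵢ, Eⱼ] = ∑ₖ structureConst i j k • Eₖ`. -/
def structureConst (τ : ℝ) (i j k : Fin 3) : ℝ :=
  (![![![0, 0, 0], ![0, 0, -2 * τ⁻¹], ![0, 2 * τ⁻¹, 0]],
    ![![0, 0, 2 * τ⁻¹], ![0, 0, 0], ![2 * τ, 0, 0]],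
    ![![0, -2 * τ⁻¹, 0], ![-2 * τ, 0, 0], ![0, 0, 0]]] : Fin 3 → Fin 3 → Fin 3 → ℝ) i j k

lemma frame_commutator {τ : ℝ} (hτ : τ ≠ 0) (i j : Fin 3) (p : Fin 4 → ℝ) :
    frame τ j (frame τ i p) - frame τ i (frame τ j p) =
      ∑ k, structureConst τ i j k • frame τ k p := by
  fin_cases i <;> fin_cases j <;> ext l <;> fin_cases l <;>
    simp [frame, X₁, X₂, X₃, structureConst, Fin.sum_univ_three] <;> field_simp <;> ring

/-- The square norm of `Eₖ` at a point `p` of `ℝ⁴` with `⟨p, p⟩ = n`. -/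
def frameNormSq (τ : ℝ) (k : Fin 3) (n : ℝ) : ℝ :=
  (![(τ ^ 2)⁻¹ * (-n + (1 + τ ^ 2) * n ^ 2), n, n] : Fin 3 → ℝ) k

lemma frameNormSq_one {τ : ℝ} (hτ : τ ≠ 0) (k : Fin 3) : frameNormSq τ k 1 = 1 := by
  fin_cases k <;> simp [frameNormSq, hτ]

lemma differentiable_frameNormSq (τ : ℝ) (k : Fin 3) : Differentiable ℝ (frameNormSq τ k) := by
  unfold frameNormSq
  fin_cases k <;> (simp only [Fin.zero_eta, Fin.mk_one, Fin.reduceFinMk, Matrix.cons_val]; fun_prop)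

/-- The frame is orthogonal at every point of `ℝ⁴` but orthonormal only on the quadric. The factor
must be kept off the quadric because `cov` differentiates components in the ambient space. -/
lemma comp_sum_frame (τ : ℝ) (c : Fin 3 → ℝ) (p : Fin 4 → ℝ) (k : Fin 3) :
    comp τ p (∑ i, c i • frame τ i p) k = c k * frameNormSq τ k (ip p p) := by
  fin_cases k <;>
    simp [comp, metric, ip, frame, X₁, X₂, X₃, frameNormSq, Fin.sum_univ_three] <;>
    ring

lemma comp_sum_frame_of_mem {τ : ℝ} (hτ : τ ≠ 0) (c : Fin 3 → ℝ) {p : Fin 4 → ℝ}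
    (hp : p ∈ quadric) (k : Fin 3) : comp τ p (∑ i, c i • frame τ i p) k = c k := by
  have hp' : ip p p = 1 := hp
  rw [comp_sum_frame, hp', frameNormSq_one hτ, mul_one]

/-- A vector tangent to the quadric is the combination of the frame given by its components. -/
lemma sum_comp_frame {τ : ℝ} (hτ : τ ≠ 0) {p v : Fin 4 → ℝ} (hp : p ∈ quadric)
    (hv : ip p v = 0) : ∑ i, comp τ p v i • frame τ i p = v := by
  have hp' : ip p p = 1 := hp
  have h0 : comp τ p v 0 = -τ * ip v (X₁ p) := by
    have h1 : ip (X₁ p) (X₁ p) = 1 := by rw [← hp']; simp [ip, X₁]; ring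
    have h2 : comp τ p v 0 =
        τ⁻¹ * ip v (X₁ p) * (1 - (1 + τ ^ 2) * ip (X₁ p) (X₁ p)) := by
      simp [comp, metric, frame, ip]; ring
    rw [h2, h1]; field_simp; ring
  have h1 : comp τ p v 1 = -ip v (X₂ p) := by
    have h3 : ip (X₂ p) (X₁ p) = 0 := by simp [ip, X₁, X₂]; ring
    simp [comp, metric, frame, h3]
  have h2 : comp τ p v 2 = -ip v (X₃ p) := by
    have h3 : ip (X₃ p) (X₁ p) = 0 := by simp [ip, X₁, X₃]; ring
    simp [comp, metric, frame, h3]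
  have hv' := hv
  simp only [ip] at hp' hv'
  -- The vectors `p`, `X₁ p`, `X₂ p`, `X₃ p` are pseudo-orthonormal with signs `+, +, -, -`; the `p`
  -- term of the expansion of `v` vanishes by tangency.
  have key : ∀ i, ip v (X₁ p) * X₁ p i - ip v (X₂ p) * X₂ p i - ip v (X₃ p) * X₃ p i = v i := by
    intro i
    fin_cases i <;> simp [ip, X₁, X₂, X₃]
    · linear_combination v 0 * hp' - p 0 * hv'
    · linear_combination v 1 * hp' - p 1 * hv'
    · linear_combination v 2 * hp' - p 2 * hv'
    · linear_combination v 3 * hp' - p 3 * hv'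
  ext i
  rw [← key i]
  simp [Fin.sum_univ_three, h0, h1, h2, frame]
  field_simp
  ring

lemma structureFun_eq {τ : ℝ} (hτ : τ ≠ 0) (i j k : Fin 3) (p : Fin 4 → ℝ) :
    structureFun τ i j k p = structureConst τ i j k * frameNormSq τ k (ip p p) := by
  have h := lieBracket_linear (frameLin τ i) (frameLin τ j) p
  simp only [frameLin_apply] at h
  rw [structureFun, show VectorField.lieBracket ℝ (frame τ i) (frame τ j) p = _ from h,
    frame_commutator hτ, comp_sum_frame]

/-! ### Connection and curvature in the frame -/

/-- The connection coefficients at a point `p` of `ℝ⁴` with `⟨p, p⟩ = n`. -/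
def connFun (τ : ℝ) (i j k : Fin 3) (n : ℝ) : ℝ :=
  (structureConst τ i j k * frameNormSq τ k n - structureConst τ j k i * frameNormSq τ i n +
    structureConst τ k i j * frameNormSq τ j n) / 2

lemma connCoeff_eq {τ : ℝ} (hτ : τ ≠ 0) (i j k : Fin 3) (p : Fin 4 → ℝ) :
    connCoeff τ i j k p = connFun τ i j k (ip p p) := by
  simp only [connCoeff, structureFun_eq hτ, connFun]

lemma differentiable_connFun (τ : ℝ) (i j k : Fin 3) : Differentiable ℝ (connFun τ i j k) := by
  have h := differentiable_frameNormSq τ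
  unfold connFun
  fun_prop

/-- The vector field `∑ₖ yₖ(⟨q, q⟩) Eₖ`. -/
def radialField (τ : ℝ) (y : Fin 3 → ℝ → ℝ) (q : Fin 4 → ℝ) : Fin 4 → ℝ :=
  ∑ k, y k (ip q q) • frame τ k q

lemma differentiable_ip_self : Differentiable ℝ (fun q : Fin 4 → ℝ => ip q q) := by
  unfold ip
  fun_prop

/-- Functions of `⟨q, q⟩` are constant in the directions spanned by the frame. -/
lemma fderiv_radial {g : ℝ → ℝ} (hg : Differentiable ℝ g) (τ : ℝ) (c : Fin 3 → ℝ)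
    (p : Fin 4 → ℝ) :
    fderiv ℝ (fun q => g (ip q q)) p (∑ i, c i • frame τ i p) = 0 := by
  set v := ∑ i, c i • frame τ i p with hv
  -- The frame is tangent to all level sets of `⟨q, q⟩`, so this function has no first order term
  -- along `v`.
  have hpv : ip p v = 0 := by
    simp [hv, ip, frame, X₁, X₂, X₃, Fin.sum_univ_three]
    ring
  have hd : DifferentiableAt ℝ (fun q => g (ip q q)) p := (hg.comp differentiable_ip_self) p
  rw [← hd.lineDeriv_eq_fderiv, lineDeriv]
  have hN : HasDerivAt (fun t : ℝ => ip (p + t • v) (p + t • v)) 0 0 := by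
    have h : (fun t : ℝ => ip (p + t • v) (p + t • v)) = fun t => ip p p + t ^ 2 * ip v v := by
      funext t
      simp only [ip, Pi.add_apply, Pi.smul_apply, smul_eq_mul] at hpv ⊢
      linear_combination 2 * t * hpv
    rw [h]
    simpa using (((hasDerivAt_id (0 : ℝ)).pow 2).mul_const (ip v v)).const_add (ip p p)
  have := (hg (ip (p + (0 : ℝ) • v) (p + (0 : ℝ) • v))).hasDerivAt.comp 0 hN
  rw [mul_zero] at this
  exact this.deriv

/-- The components of the covariant derivative of two radial fields. -/
def radialCov (τ : ℝ) (x y : Fin 3 → ℝ → ℝ) (k : Fin 3) (n : ℝ) : ℝ :=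
  ∑ i, ∑ j, connFun τ i j k n * (x i n * frameNormSq τ i n) * (y j n * frameNormSq τ j n)

/-- Radial fields are closed under `cov`, since the derivative of a radial coefficient along the
frame vanishes. Constant coefficients would not suffice: one covariant derivative already introduces
the factors `frameNormSq`, and the curvature needs two. -/
lemma cov_radialField {τ : ℝ} (hτ : τ ≠ 0) (x : Fin 3 → ℝ → ℝ) {y : Fin 3 → ℝ → ℝ}
    (hy : ∀ k, Differentiable ℝ (y k)) :
    cov τ (radialField τ x) (radialField τ y) = radialField τ (radialCov τ x y) := by
  funext p
  rw [cov, show radialField τ (radialCov τ x y) p =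
    ∑ k, radialCov τ x y k (ip p p) • frame τ k p from rfl]
  refine Finset.sum_congr rfl fun k _ => ?_
  have h1 : (fun q => comp τ q (radialField τ y q) k) =
      fun q => (fun n => y k n * frameNormSq τ k n) (ip q q) := by
    funext q
    exact comp_sum_frame τ (fun i => y i (ip q q)) q k
  have h2 : fderiv ℝ (fun q => comp τ q (radialField τ y q) k) p (radialField τ x p) = 0 := by
    rw [h1]
    exact fderiv_radial ((hy k).mul (differentiable_frameNormSq τ k)) τ
      (fun i => x i (ip p p)) p
  have h3 : ∀ (z : Fin 3 → ℝ → ℝ) (i : Fin 3), comp τ p (radialField τ z p) i =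
      z i (ip p p) * frameNormSq τ i (ip p p) := fun z i =>
    comp_sum_frame τ (fun i => z i (ip p p)) p i
  rw [h2, zero_add]
  simp only [h3, connCoeff_eq hτ, radialCov]

lemma differentiable_radialCov (τ : ℝ) {x y : Fin 3 → ℝ → ℝ}
    (hx : ∀ k, Differentiable ℝ (x k)) (hy : ∀ k, Differentiable ℝ (y k)) (k : Fin 3) :
    Differentiable ℝ (radialCov τ x y k) := by
  have h := differentiable_frameNormSq τ
  have h' := differentiable_connFun τ
  unfold radialCov
  fun_prop

/-- The identity holds on all of `ℝ⁴`, so the bracket term of the curvature is again covered by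
`cov_radialField`. -/
lemma lieBracket_const {τ : ℝ} (hτ : τ ≠ 0) (x y : Fin 3 → ℝ) :
    VectorField.lieBracket ℝ (radialField τ fun i _ => x i) (radialField τ fun i _ => y i) =
      radialField τ fun k _ => ∑ i, ∑ j, x i * y j * structureConst τ i j k := by
  have hlin : ∀ z : Fin 3 → ℝ, (radialField τ fun i _ => z i) =
      fun q => (∑ i, z i • frameLin τ i) q := by
    intro z
    funext q
    simp [radialField, LinearMap.sum_apply]
  funext p
  rw [hlin, hlin, lieBracket_linear, radialField]
  have : ∀ i j : Fin 3, frame τ j (frame τ i p) = frame τ i (frame τ j p) +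
      ∑ k, structureConst τ i j k • frame τ k p := fun i j => by
    rw [← frame_commutator hτ]; abel
  ext l
  have h01 := congrFun (this 0 1) l
  have h02 := congrFun (this 0 2) l
  have h12 := congrFun (this 1 2) l
  have hs : ∀ i (v w : Fin 4 → ℝ), frame τ i (v + w) = frame τ i v + frame τ i w :=
    fun i v w => (frameLin τ i).map_add v w
  have hm : ∀ i (c : ℝ) (v : Fin 4 → ℝ), frame τ i (c • v) = c • frame τ i v :=
    fun i c v => (frameLin τ i).map_smul c v
  simp [Fin.sum_univ_three, structureConst, hs, hm] at h01 h02 h12 ⊢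
  linear_combination (x 0 * y 1 - x 1 * y 0) * h01 + (x 0 * y 2 - x 2 * y 0) * h02 +
    (x 1 * y 2 - x 2 * y 1) * h12

lemma radialField_of_mem {τ : ℝ} {p : Fin 4 → ℝ} (hp : p ∈ quadric) (y : Fin 3 → ℝ → ℝ) :
    radialField τ y p = ∑ k, y k 1 • frame τ k p := by
  have hp' : ip p p = 1 := hp
  rw [radialField, hp']

/-- The components of `R(t, p) t` for `t` a unit vector orthogonal to `p`. -/
def curvComp (τ : ℝ) (t p : Fin 3 → ℝ) : Fin 3 → ℝ :=
  ![-τ ^ 2 * p 0,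
    -τ ^ 2 * p 1 - (4 + 4 * τ ^ 2) * (t 1 * p 2 - t 2 * p 1) * t 2,
    -τ ^ 2 * p 2 + (4 + 4 * τ ^ 2) * (t 1 * p 2 - t 2 * p 1) * t 1]

/-- The term `-τ² p` is what constant curvature `τ²` would give. The correction involves only the
horizontal area `t₁p₂ - t₂p₁`, and accounts for the curvature `-(4 + 3τ²)` of the horizontal plane.
-/
lemma curv_eq {τ : ℝ} (hτ : τ ≠ 0) {x : Fin 4 → ℝ} (hx : x ∈ quadric) (t p : Fin 3 → ℝ)
    (ht : t 0 ^ 2 + t 1 ^ 2 + t 2 ^ 2 = 1) (htp : t 0 * p 0 + t 1 * p 1 + t 2 * p 2 = 0) :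
    curv τ x (∑ i, t i • frame τ i x) (∑ i, p i • frame τ i x) (∑ i, t i • frame τ i x) =
      ∑ k, curvComp τ t p k • frame τ k x := by
  have he : ∀ c : Fin 3 → ℝ, extend τ x (∑ i, c i • frame τ i x) =
      radialField τ fun i _ => c i := by
    intro c
    funext q
    simp only [extend, comp_sum_frame_of_mem hτ c hx, radialField]
  have hc : ∀ (c : Fin 3 → ℝ) k, Differentiable ℝ ((fun i _ => c i : Fin 3 → ℝ → ℝ) k) :=
    fun c k => differentiable_const _
  rw [curv, he, he, curvField, lieBracket_const hτ, cov_radialField hτ _ (hc t),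
    cov_radialField hτ _ (hc t), cov_radialField hτ _ (hc t),
    cov_radialField hτ _ (differentiable_radialCov τ (hc p) (hc t)),
    cov_radialField hτ _ (differentiable_radialCov τ (hc t) (hc t)),
    radialField_of_mem hx, radialField_of_mem hx, radialField_of_mem hx,
    ← Finset.sum_sub_distrib, ← Finset.sum_sub_distrib]
  refine Finset.sum_congr rfl fun k _ => ?_
  rw [← sub_smul, ← sub_smul]
  congr 1
  fin_cases k <;>
    simp [radialCov, frameNormSq_one hτ, Fin.sum_univ_three, connFun, structureConst,
      curvComp] <;> field_simp
  · linear_combination τ ^ 2 * t 0 * htp - τ ^ 2 * p 0 * ht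
  · linear_combination τ ^ 4 * t 1 * htp - τ ^ 4 * p 1 * ht
  · linear_combination τ ^ 4 * t 2 * htp - τ ^ 4 * p 2 * ht

/-! ### Covariant differentiation along a curve -/

/-- The zeroth order part of the covariant derivative, in frame components, of a field with
components `v` along a curve whose velocity has components `t`. -/
def connPart (τ : ℝ) (t v : Fin 3 → ℝ) : Fin 3 → ℝ :=
  ![τ * (t 1 * v 2 - t 2 * v 1), (2 * τ⁻¹ + τ) * t 0 * v 2 + τ * t 2 * v 0,
    -((2 * τ⁻¹ + τ) * t 0 * v 1) - τ * t 1 * v 0]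

lemma covAlong_eq {τ : ℝ} (hτ : τ ≠ 0) {I : Set ℝ} (hI : IsOpen I) {γ V : ℝ → Fin 4 → ℝ}
    (hγ : ∀ s ∈ I, γ s ∈ quadric) {t v : ℝ → Fin 3 → ℝ}
    (ht : ∀ s ∈ I, deriv γ s = ∑ i, t s i • frame τ i (γ s))
    (hv : ∀ s ∈ I, V s = ∑ i, v s i • frame τ i (γ s)) {s : ℝ} (hs : s ∈ I) :
    covAlong τ γ V s =
      ∑ k, (deriv (fun u => v u k) s + connPart τ (t s) (v s) k) • frame τ k (γ s) := by
  have hg : ip (γ s) (γ s) = 1 := hγ s hs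
  rw [covAlong]
  refine Finset.sum_congr rfl fun k _ => ?_
  have h1 : deriv (fun u => comp τ (γ u) (V u) k) s = deriv (fun u => v u k) s := by
    refine Filter.EventuallyEq.deriv_eq ?_
    filter_upwards [hI.mem_nhds hs] with u hu
    rw [hv u hu, comp_sum_frame_of_mem hτ _ (hγ u hu)]
  rw [h1, ht s hs, hv s hs]
  simp only [comp_sum_frame_of_mem hτ _ (hγ s hs), connCoeff_eq hτ, hg]
  congr 2
  fin_cases k <;>
    simp [frameNormSq_one hτ, Fin.sum_univ_three, connFun, structureConst, connPart,
      -mul_eq_mul_right_iff, -mul_eq_mul_left_iff] <;>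
    field_simp <;> ring

lemma exists_const_of_hasDerivAt_zero {I : Set ℝ} (hI : IsOpen I) (hI' : I.OrdConnected)
    {f : ℝ → ℝ} (hf : ∀ s ∈ I, HasDerivAt f 0 s) : ∃ c, ∀ s ∈ I, f s = c :=
  hI.exists_is_const_of_deriv_eq_zero hI'.isPreconnected
    (fun s hs => (hf s hs).differentiableAt.differentiableWithinAt)
    (fun s hs => (hf s hs).deriv)

/-- This serves to differentiate an identity that holds on the open set `I`. -/
lemma derivAt_eq_zero_of_eventually_const {f : ℝ → ℝ} {f' c s : ℝ} (hf : HasDerivAt f f' s)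
    (hc : ∀ᶠ u in nhds s, f u = c) : f' = 0 :=
  hf.unique ((hasDerivAt_const s c).congr_of_eventuallyEq hc)

/-! ### The biharmonic equation in frame components -/

/-- The scalar product of `ℝ³`. -/
def dot (v w : Fin 3 → ℝ) : ℝ := v 0 * w 0 + v 1 * w 1 + v 2 * w 2

/-- The vector product of `ℝ³`. -/
def cross (v w : Fin 3 → ℝ) : Fin 3 → ℝ :=
  ![v 1 * w 2 - v 2 * w 1, v 2 * w 0 - v 0 * w 2, v 0 * w 1 - v 1 * w 0]

lemma dot_cross_self (t p : Fin 3 → ℝ) :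
    dot (cross t p) (cross t p) = dot t t * dot p p - dot t p ^ 2 := by
  simp only [dot, cross, Matrix.cons_val]
  ring

/-- Expansion of a vector in the orthogonal basis `t`, `p`, `t × p`. -/
lemma cross_expansion (t p q : Fin 3 → ℝ) (i : Fin 3) :
    dot (cross t p) (cross t p) * q i =
      dot t q * (t i * dot p p - p i * dot t p) + dot p q * (p i * dot t t - t i * dot t p) +
        dot q (cross t p) * cross t p i := by
  fin_cases i <;> simp [dot, cross] <;> ring

/-- In frame components along a curve with velocity `t`, the field `v` has covariant
derivative `v'` on `I`. -/
def IsCovDeriv (τ : ℝ) (I : Set ℝ) (t v v' : ℝ → Fin 3 → ℝ) : Prop :=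
  ∀ s ∈ I, ∀ k, HasDerivAt (fun u => v u k) (v' s k - connPart τ (t s) (v s) k) s

/-- The connection is metric. -/
lemma IsCovDeriv.dot {τ : ℝ} {I : Set ℝ} {t v v' w w' : ℝ → Fin 3 → ℝ}
    (hv : IsCovDeriv τ I t v v') (hw : IsCovDeriv τ I t w w') {s : ℝ} (hs : s ∈ I) :
    HasDerivAt (fun u => dot (v u) (w u)) (dot (v' s) (w s) + dot (v s) (w' s)) s := by
  have h := (((hv s hs 0).mul (hw s hs 0)).add ((hv s hs 1).mul (hw s hs 1))).add
    ((hv s hs 2).mul (hw s hs 2))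
  refine h.congr_deriv ?_
  simp only [SL2Tau.dot, connPart, Matrix.cons_val]
  ring

/-- The component along `E₁` of a biharmonic curve of constant nonzero curvature is constant;
here `p`, `w`, `g` are the `E₁` components of the normal, the binormal and the torsion, up to
powers of the curvature. -/
lemma normal_component_eq_zero {τ : ℝ} (hτ : τ ≠ 0) {I : Set ℝ} (hI : IsOpen I)
    {p w g : ℝ → ℝ} {k : ℝ} (hk : 0 < k)
    (hp : ∀ s ∈ I, ContinuousAt p s)
    (hw : ∀ s ∈ I, HasDerivAt w ((τ - g s / k) * p s) s)
    (hg : ∀ s ∈ I, HasDerivAt g (-(4 + 4 * τ ^ 2) * w s * p s) s)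
    (hrel : ∀ s ∈ I, k ^ 3 + g s ^ 2 = τ ^ 2 * k ^ 2 - (4 + 4 * τ ^ 2) * k * w s ^ 2) :
    ∀ s ∈ I, p s = 0 := by
  have hC : 0 < 4 + 4 * τ ^ 2 := by positivity
  -- By `hrel`, `g² + (4 + 4τ²) k w²` is constant; its derivative is a multiple of this product.
  have h1 : ∀ s ∈ I, w s * p s * (2 * g s - k * τ) = 0 := by
    intro s hs
    have hd := ((hg s hs).pow 2).add (((hw s hs).pow 2).const_mul ((4 + 4 * τ ^ 2) * k))
    have hz := derivAt_eq_zero_of_eventually_const (c := τ ^ 2 * k ^ 2 - k ^ 3) hd (by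
      filter_upwards [hI.mem_nhds hs] with u hu
      have := hrel u hu
      simp only [Pi.add_apply, Pi.pow_apply]
      linarith)
    field_simp at hz
    simp only [Nat.cast_ofNat, pow_one, Nat.add_one_sub_one] at hz
    have : (4 + 4 * τ ^ 2) * (w s * p s * (2 * g s - k * τ)) = 0 := by linarith
    exact (mul_eq_zero.mp this).resolve_left hC.ne'
  -- Where `w p ≠ 0`, the previous step makes `g` locally equal to `kτ/2`, hence `g' = 0`, which
  -- contradicts `hg`.
  have h2 : ∀ s ∈ I, w s * p s = 0 := by
    intro s hs
    by_contra hne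
    have hc : ContinuousAt (fun u => w u * p u) s := (hw s hs).continuousAt.mul (hp s hs)
    have hz := derivAt_eq_zero_of_eventually_const (c := k * τ / 2) (hg s hs) (by
      filter_upwards [hI.mem_nhds hs, hc.eventually_ne hne] with u hu hu'
      have := (mul_eq_zero.mp (h1 u hu)).resolve_left hu'
      linarith)
    rw [mul_assoc] at hz
    exact hne ((mul_eq_zero.mp hz).resolve_left (by linarith))
  intro s hs
  by_contra hne
  -- If `p s ≠ 0`, then `w` vanishes near `s`; `w' = 0` gives `g = kτ`, and `hrel` reduces to `k³ =
  -- 0`.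
  have hev : ∀ᶠ u in nhds s, w u = 0 := by
    filter_upwards [hI.mem_nhds hs, (hp s hs).eventually_ne hne] with u hu hu'
    exact (mul_eq_zero.mp (h2 u hu)).resolve_right hu'
  have hz := derivAt_eq_zero_of_eventually_const (hw s hs) hev
  have hgs : g s = k * τ := by
    have := (mul_eq_zero.mp hz).resolve_right hne
    field_simp at this
    linarith
  have hr := hrel s hs
  rw [hgs, hev.self_of_nhds] at hr
  have : k ^ 3 = 0 := by linarith
  exact absurd this (by positivity)

/-- The velocity of a proper biharmonic curve makes a constant angle with `E₁` and rotates
uniformly about it. -/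
theorem biharmonic_system {τ : ℝ} (hτ : τ ≠ 0) {I : Set ℝ} (hI : IsOpen I)
    (hI' : I.OrdConnected) {t p q : ℝ → Fin 3 → ℝ} (ht : IsCovDeriv τ I t t p)
    (hp : IsCovDeriv τ I t p q)
    (hq : IsCovDeriv τ I t q fun s => curvComp τ (t s) (p s))
    (h1 : ∀ s ∈ I, dot (t s) (t s) = 1) (hne : ∃ s ∈ I, p s ≠ 0) :
    ∃ c b : ℝ, c ^ 2 < 1 ∧
      (b + (2 * τ⁻¹ + 2 * τ) * c) ^ 2 - 2 * τ * (b + (2 * τ⁻¹ + 2 * τ) * c) * c +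
        (4 + 4 * τ ^ 2) * (1 - c ^ 2) = 0 ∧
      ∀ s ∈ I, t s 0 = c ∧ HasDerivAt (fun u => t u 1) (b * t s 2) s ∧
        HasDerivAt (fun u => t u 2) (-b * t s 1) s := by
  -- In Frenet terms `t = T`, `p = κN` and `q = ∇p`. The quantities below are `k = κ²`, `w = κB₁`
  -- and `g = κ² · torsion`.
  have htp : ∀ s ∈ I, dot (t s) (p s) = 0 := by
    intro s hs
    have := derivAt_eq_zero_of_eventually_const (ht.dot ht hs) (by
      filter_upwards [hI.mem_nhds hs] with u hu using h1 u hu)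
    simp only [dot] at this ⊢
    linarith
  have htq : ∀ s ∈ I, dot (t s) (q s) = -dot (p s) (p s) := by
    intro s hs
    have := derivAt_eq_zero_of_eventually_const (ht.dot hp hs) (by
      filter_upwards [hI.mem_nhds hs] with u hu using htp u hu)
    linarith
  -- The derivative of `⟨t, q⟩ + |p|² = 0` is `3⟨p, q⟩ = 0`, because `R(t, p)t` is orthogonal to
  -- `t`. Hence the curvature is constant.
  have hpq : ∀ s ∈ I, dot (p s) (q s) = 0 := by
    intro s hs
    have := derivAt_eq_zero_of_eventually_const ((ht.dot hq hs).add (hp.dot hp hs)) (c := 0) (by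
      filter_upwards [hI.mem_nhds hs] with u hu
      simp [htq u hu])
    have h := htp s hs
    simp only [dot, curvComp, Matrix.cons_val] at this h ⊢
    linear_combination this / 3 + τ ^ 2 / 3 * h
  obtain ⟨k, hk⟩ : ∃ k, ∀ s ∈ I, dot (p s) (p s) = k :=
    exists_const_of_hasDerivAt_zero hI hI' fun s hs => (hp.dot hp hs).congr_deriv (by
      have := hpq s hs
      simp only [dot] at this ⊢
      linarith)
  have hk0 : 0 < k := by
    obtain ⟨s, hs, hps⟩ := hne
    rw [← hk s hs]
    by_contra hle
    simp only [dot] at hle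
    apply hps
    have h0 := mul_self_nonneg (p s 0)
    have h1 := mul_self_nonneg (p s 1)
    have h2 := mul_self_nonneg (p s 2)
    rw [not_lt] at hle
    ext i
    fin_cases i
    · exact (mul_self_eq_zero (M₀ := ℝ) (a := p s 0)).mp (le_antisymm (by linarith) h0)
    · exact (mul_self_eq_zero (M₀ := ℝ) (a := p s 1)).mp (le_antisymm (by linarith) h1)
    · exact (mul_self_eq_zero (M₀ := ℝ) (a := p s 2)).mp (le_antisymm (by linarith) h2)
  have hqq : ∀ s ∈ I, dot (q s) (q s) =
      τ ^ 2 * k - (4 + 4 * τ ^ 2) * (t s 1 * p s 2 - t s 2 * p s 1) ^ 2 := by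
    intro s hs
    have := derivAt_eq_zero_of_eventually_const (hp.dot hq hs) (c := 0) (by
      filter_upwards [hI.mem_nhds hs] with u hu using hpq u hu)
    have h := hk s hs
    simp only [dot, curvComp, Matrix.cons_val] at this h ⊢
    linear_combination this + τ ^ 2 * h
  set w : ℝ → ℝ := fun s => t s 1 * p s 2 - t s 2 * p s 1 with hwdef
  set g : ℝ → ℝ := fun s => dot (q s) (cross (t s) (p s)) with hgdef
  have hexp : ∀ s ∈ I, ∀ i, k * q s i = -k ^ 2 * t s i + g s * cross (t s) (p s) i := by
    intro s hs i
    have h := cross_expansion (t s) (p s) (q s) i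
    rw [dot_cross_self, h1 s hs, htp s hs, htq s hs, hpq s hs, hk s hs] at h
    linear_combination h
  have hw : ∀ s ∈ I, HasDerivAt w ((τ - g s / k) * p s 0) s := by
    intro s hs
    have h := ((ht s hs 1).mul (hp s hs 2)).sub ((ht s hs 2).mul (hp s hs 1))
    refine h.congr_deriv ?_
    have e1 := h1 s hs
    have e2 := htp s hs
    have x1 := hexp s hs 1
    have x2 := hexp s hs 2
    rw [← mul_right_inj' hk0.ne',
      show k * ((τ - g s / k) * p s 0) = (τ * k - g s) * p s 0 by field_simp]
    simp only [dot, connPart, cross, Matrix.cons_val] at *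
    linear_combination t s 1 * x2 - t s 2 * x1 + (-g s * p s 0 + τ * k * p s 0) * e1 +
      (g s * t s 0 - τ * k * t s 0) * e2
  have hg : ∀ s ∈ I, HasDerivAt g (-(4 + 4 * τ ^ 2) * w s * p s 0) s := by
    intro s hs
    have h := (((hq s hs 0).mul (((ht s hs 1).mul (hp s hs 2)).sub
      ((ht s hs 2).mul (hp s hs 1)))).add ((hq s hs 1).mul (((ht s hs 2).mul (hp s hs 0)).sub
      ((ht s hs 0).mul (hp s hs 2))))).add ((hq s hs 2).mul (((ht s hs 0).mul (hp s hs 1)).sub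
      ((ht s hs 1).mul (hp s hs 0))))
    refine h.congr_deriv ?_
    have e1 := h1 s hs
    have e2 := htp s hs
    simp only [hwdef]
    simp only [dot, connPart, curvComp, Matrix.cons_val, Pi.sub_apply, Pi.mul_apply] at *
    linear_combination -(4 + 4 * τ ^ 2) * (t s 1 * p s 2 - t s 2 * p s 1) *
      (p s 0 * e1 - t s 0 * e2)
  -- Two expressions for `k|q|²`: one from the expansion of `q` in the basis `t`, `p`, `t × p`, the
  -- other from `hqq`, the derivative of `⟨p, q⟩ = 0`.
  have hrel : ∀ s ∈ I, k ^ 3 + g s ^ 2 = τ ^ 2 * k ^ 2 - (4 + 4 * τ ^ 2) * k * w s ^ 2 := by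
    intro s hs
    have x0 := hexp s hs 0
    have x1 := hexp s hs 1
    have x2 := hexp s hs 2
    have e4 := htq s hs
    have e6 := hqq s hs
    rw [hk s hs] at e4
    have hgs : g s = q s 0 * cross (t s) (p s) 0 + q s 1 * cross (t s) (p s) 1 +
      q s 2 * cross (t s) (p s) 2 := rfl
    simp only [dot] at e4 e6
    linear_combination k * e6 - q s 0 * x0 - q s 1 * x1 - q s 2 * x2 + k ^ 2 * e4 + g s * hgs
  have hp0 : ∀ s ∈ I, p s 0 = 0 :=
    normal_component_eq_zero hτ hI hk0 (fun s hs => (hp s hs 0).continuousAt) hw hg hrel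
  obtain ⟨c, hc⟩ : ∃ c, ∀ s ∈ I, t s 0 = c :=
    exists_const_of_hasDerivAt_zero hI hI' fun s hs => (ht s hs 0).congr_deriv (by
      simp only [connPart, hp0 s hs, Matrix.cons_val]; ring)
  obtain ⟨m, hm⟩ : ∃ m, ∀ s ∈ I, w s = m :=
    exists_const_of_hasDerivAt_zero hI hI' fun s hs => (hw s hs).congr_deriv (by
      simp [hp0 s hs])
  have hn : ∀ s ∈ I, t s 1 ^ 2 + t s 2 ^ 2 = 1 - c ^ 2 := by
    intro s hs
    have e1 := h1 s hs
    rw [dot, hc s hs] at e1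
    linear_combination e1
  have hort : ∀ s ∈ I, t s 1 * p s 1 + t s 2 * p s 2 = 0 := by
    intro s hs
    have e2 := htp s hs
    rw [dot, hp0 s hs] at e2
    linear_combination e2
  obtain ⟨s₀, hs₀, -⟩ := hne
  have hq0 : q s₀ 0 = τ * m := by
    have := derivAt_eq_zero_of_eventually_const (hp s₀ hs₀ 0) (c := 0) (by
      filter_upwards [hI.mem_nhds hs₀] with u hu using hp0 u hu)
    rw [← hm s₀ hs₀]
    simp only [connPart, Matrix.cons_val] at this
    linear_combination this
  have hx : k * (τ * m) = -k ^ 2 * c + g s₀ * m := by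
    have := hexp s₀ hs₀ 0
    rw [hq0, hc s₀ hs₀] at this
    rw [this, ← hm s₀ hs₀]
    rfl
  have hkn : k * (1 - c ^ 2) = m ^ 2 := by
    have e3 := hk s₀ hs₀
    rw [dot, hp0 s₀ hs₀] at e3
    have e7 := hm s₀ hs₀
    simp only [hwdef] at e7
    rw [← hn s₀ hs₀, ← e7, ← e3]
    linear_combination (t s₀ 1 * p s₀ 1 + t s₀ 2 * p s₀ 2) * hort s₀ hs₀
  -- If `c² = 1`, then `hkn` gives `m = 0`, and `hx` then forces `c = 0`.
  have hn0 : 0 < 1 - c ^ 2 := by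
    refine lt_of_le_of_ne ?_ fun h0 => ?_
    · rw [← hn s₀ hs₀]; positivity
    · rw [← h0, mul_zero, eq_comm, pow_eq_zero_iff two_ne_zero] at hkn
      rw [hkn] at hx
      have : k ^ 2 * c = 0 := by linarith
      have hc0 : c = 0 := (mul_eq_zero.mp this).resolve_left (by positivity)
      rw [hc0] at h0
      norm_num at h0
  have hm0 : m ≠ 0 := by
    rintro rfl
    have : 0 < k * (1 - c ^ 2) := mul_pos hk0 hn0
    rw [hkn] at this
    norm_num at this
  -- As `p` is horizontal and orthogonal to `(t₁, t₂)`, it equals `h · (0, t₂, -t₁)`, which makes `w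
  -- = -h(1 - c²)`.
  obtain ⟨h, hh⟩ : ∃ h, m = -h * (1 - c ^ 2) := ⟨-m / (1 - c ^ 2), by field_simp⟩
  have hh0 : h ≠ 0 := by
    rintro rfl
    exact hm0 (by rw [hh]; ring)
  have hkh : k = h ^ 2 * (1 - c ^ 2) := by
    rw [hh] at hkn
    exact mul_right_cancel₀ hn0.ne' (by linear_combination hkn)
  have hgh : g s₀ = k * (τ - h * c) := by
    refine mul_right_cancel₀ hm0 ?_
    rw [show g s₀ * m = k * (τ * m) + k * (k * c) by linear_combination -hx]
    rw [hh]
    linear_combination k * c * hkh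
  -- The rotation speed is `h` minus the contribution `(2τ⁻¹ + 2τ)c` of `connPart` to `∇_T T`.
  -- Dividing `hrel` by `k²` gives the quadratic equation for `h`.
  refine ⟨c, h - (2 * τ⁻¹ + 2 * τ) * c, by linarith, ?_, fun s hs => ⟨hc s hs, ?_, ?_⟩⟩
  · have hr := hrel s₀ hs₀
    rw [hm s₀ hs₀, hgh, hh] at hr
    refine ((mul_eq_zero (a := k ^ 2)).mp ?_).resolve_left (by positivity)
    linear_combination hr + (-k ^ 2 + (4 + 4 * τ ^ 2) * k * (1 - c ^ 2)) * hkh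
  · refine (ht s hs 1).congr_deriv (mul_left_cancel₀ hn0.ne' ?_)
    have e7 := hm s hs
    rw [hh] at e7
    simp only [hwdef] at e7
    simp only [connPart, Matrix.cons_val, hc s hs]
    linear_combination -p s 1 * hn s hs + t s 1 * hort s hs - t s 2 * e7
  · refine (ht s hs 2).congr_deriv (mul_left_cancel₀ hn0.ne' ?_)
    have e7 := hm s hs
    rw [hh] at e7
    simp only [hwdef] at e7
    simp only [connPart, Matrix.cons_val, hc s hs]
    linear_combination -p s 2 * hn s hs + t s 2 * hort s hs + t s 1 * e7

/-! ### The roots of the biharmonicity equation -/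

/-- This form shows `b² < 4a` to be a bound on `b + 2τ⁻¹ cos ϑ`, and gives `μ² = sin² ϑ - d²` with
`d = τ⁻¹ cos ϑ + b/2`. -/
lemma four_aConst_sub {τ : ℝ} (hτ : τ ≠ 0) (ϑ b : ℝ) :
    4 * aConst τ ϑ b - b ^ 2 =
      4 * (Real.sin ϑ ^ 2 - (τ⁻¹ * Real.cos ϑ + b / 2) ^ 2) := by
  rw [aConst, Real.cos_two_mul, Real.sin_sq]
  field_simp
  ring

/-- The real roots `x` of the biharmonicity equation that satisfy `b² < 4a`, for
`0 ≤ cos ϑ = c`. -/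
lemma root_eq_of_nonneg {τ c x : ℝ} (hτ : 0 < τ) (hc : 0 ≤ c)
    (hroot : x ^ 2 - 2 * τ * x * c + (4 + 4 * τ ^ 2) * (1 - c ^ 2) = 0)
    (hlt : (x - 2 * τ * c) ^ 2 < 4 * (1 - c ^ 2)) :
    x = τ * c + Real.sqrt ((4 + 5 * τ ^ 2) * c ^ 2 - 4 * (1 + τ ^ 2)) ∧
      (2 + τ ^ 2) ^ 2 / (4 + 5 * τ ^ 2 + τ ^ 4) < c ^ 2 := by
  set D := (4 + 5 * τ ^ 2) * c ^ 2 - 4 * (1 + τ ^ 2) with hD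
  have hsq : (x - τ * c) ^ 2 = D := by rw [hD]; linear_combination hroot
  have hD0 : 0 ≤ D := hsq ▸ sq_nonneg _
  have hc1 : c ^ 2 < 1 := by nlinarith [sq_nonneg (x - 2 * τ * c)]
  have hlow : 0 ≤ (8 + 6 * τ ^ 2) * c ^ 2 - (8 + 4 * τ ^ 2) := by
    have h1 : (4 + 5 * τ ^ 2) * ((8 + 6 * τ ^ 2) * c ^ 2 - (8 + 4 * τ ^ 2)) =
        (8 + 6 * τ ^ 2) * D + 4 * τ ^ 4 := by rw [hD]; ring
    have h2 : 0 < 4 + 5 * τ ^ 2 := by positivity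
    have h3 : 0 ≤ (8 + 6 * τ ^ 2) * D + 4 * τ ^ 4 := by positivity
    rw [← h1] at h3
    exact nonneg_of_mul_nonneg_right h3 h2
  -- This is `hlt` expanded around `τc`, with `(x - τc)²` replaced by `D`. The left side is
  -- nonnegative because `D ≥ 0`, so `x - τc` is the positive root.
  have hkey : (8 + 6 * τ ^ 2) * c ^ 2 - (8 + 4 * τ ^ 2) < 2 * τ * c * (x - τ * c) := by
    rw [hD] at hsq
    nlinarith
  have hpos : 0 < x - τ * c := by
    have h1 : 0 < 2 * τ * c * (x - τ * c) := hlow.trans_lt hkey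
    exact pos_of_mul_pos_right h1 (by positivity)
  refine ⟨?_, ?_⟩
  · rw [← hsq, Real.sqrt_sq hpos.le]; ring
  · rw [div_lt_iff₀ (by positivity)]
    -- After squaring, `c² = 1` is a root of the difference of the two sides; splitting off `1 - c²
    -- > 0` leaves the asserted bound.
    have h1 := mul_self_lt_mul_self hlow hkey
    have h2 : 2 * τ * c * (x - τ * c) * (2 * τ * c * (x - τ * c)) = 4 * τ ^ 2 * c ^ 2 * D := by
      rw [← hsq]; ring
    rw [h2, hD] at h1
    have h3 : 0 < (1 - c ^ 2) * (c ^ 2 * (4 + 5 * τ ^ 2 + τ ^ 4) - (2 + τ ^ 2) ^ 2) := by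
      linarith
    linarith [pos_of_mul_pos_right h3 (by linarith)]

/-! ### Integration to the model curve -/

/-- The hyperbolic rotation of `(G, H)` by `-μs` is constant. The base point `s₀` is arbitrary
because `0` need not lie in `I`. -/
lemma eq_of_hasDerivAt_pair {I : Set ℝ} (hI : IsOpen I) (hI' : I.OrdConnected) {μ : ℝ}
    {G H : ℝ → ℝ} (hG : ∀ s ∈ I, HasDerivAt G (μ * H s) s)
    (hH : ∀ s ∈ I, HasDerivAt H (μ * G s) s) {s₀ : ℝ} (hs₀ : s₀ ∈ I) :
    ∀ s ∈ I, G s =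
      Real.cosh (μ * s) * (Real.cosh (μ * s₀) * G s₀ - Real.sinh (μ * s₀) * H s₀) +
      Real.sinh (μ * s) * (Real.cosh (μ * s₀) * H s₀ - Real.sinh (μ * s₀) * G s₀) := by
  have hc : ∀ s, HasDerivAt (fun u => Real.cosh (μ * u)) (μ * Real.sinh (μ * s)) s := fun s =>
    (((hasDerivAt_id s).const_mul μ).cosh).congr_deriv (by simp; ring)
  have hs : ∀ s, HasDerivAt (fun u => Real.sinh (μ * u)) (μ * Real.cosh (μ * s)) s := fun s =>
    (((hasDerivAt_id s).const_mul μ).sinh).congr_deriv (by simp; ring)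
  have hconst : ∀ f : ℝ → ℝ, (∀ s ∈ I, HasDerivAt f 0 s) → ∀ s ∈ I, f s = f s₀ := by
    intro f hf s hs
    exact hI.is_const_of_deriv_eq_zero hI'.isPreconnected
      (fun u hu => (hf u hu).differentiableAt.differentiableWithinAt)
      (fun u hu => (hf u hu).deriv) hs hs₀
  have hU := hconst (fun u => Real.cosh (μ * u) * G u - Real.sinh (μ * u) * H u) fun s hsI =>
    (((hc s).mul (hG s hsI)).sub ((hs s).mul (hH s hsI))).congr_deriv (by ring)
  have hV := hconst (fun u => Real.cosh (μ * u) * H u - Real.sinh (μ * u) * G u) fun s hsI =>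
    (((hc s).mul (hH s hsI)).sub ((hs s).mul (hG s hsI))).congr_deriv (by ring)
  intro s hsI
  have h1 := hU s hsI
  have h2 := hV s hsI
  have h3 := Real.cosh_sq_sub_sinh_sq (μ * s)
  rw [← h1, ← h2]
  linear_combination -G s * h3

/-- The matrix with columns `U`, `J₁ U`, `F`, `J₁ F`. -/
def frameMatrix (U F : Fin 4 → ℝ) : Matrix (Fin 4) (Fin 4) ℝ :=
  Matrix.of fun i => ![U i, X₁ U i, F i, X₁ F i]

lemma frameMatrix_commute (U F : Fin 4 → ℝ) : frameMatrix U F * J₁ = J₁ * frameMatrix U F := by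
  ext i j
  fin_cases i <;> fin_cases j <;>
    simp [frameMatrix, J₁, X₁, Matrix.mul_apply, Fin.sum_univ_four]

/-- The last two hypotheses say that `U` and `F` are orthogonal for the Hermitian form of signature
`(1, 1)`; the remaining products of columns follow because `J₁` is an isometry. -/
lemma frameMatrix_mem {U F : Fin 4 → ℝ} (hU : ip U U = 1) (hF : ip F F = -1)
    (hUF : ip U F = 0) (hUF' : ip (X₁ U) F = 0) : frameMatrix U F ∈ O₂4 := by
  have hε : epsMat * epsMat = 1 := by
    ext i j
    fin_cases i <;> fin_cases j <;> simp [epsMat, Matrix.mul_apply, Fin.sum_univ_four]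
  have h : (epsMat * (frameMatrix U F)ᵀ * epsMat) * frameMatrix U F = 1 := by
    simp only [ip, X₁, Matrix.cons_val] at hU hF hUF hUF'
    ext i j
    fin_cases i <;> fin_cases j <;>
      simp [epsMat, frameMatrix, X₁, Matrix.mul_apply, Fin.sum_univ_four, Matrix.diagonal_apply]
      <;> linarith
  refine ⟨IsUnit.of_mul_eq_one_right _ h, ?_⟩
  rw [Matrix.inv_eq_left_inv h, ← mul_assoc, ← mul_assoc, hε, one_mul, mul_assoc, hε, mul_one]

/-- A curve whose velocity has constant angle with `E₁` and rotates with angular speed `b`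
is congruent to the model curve. -/
theorem exists_congruence {τ : ℝ} (hτ : τ ≠ 0) {I : Set ℝ} (hI : IsOpen I)
    (hI' : I.OrdConnected) (hne : I.Nonempty) {γ : ℝ → Fin 4 → ℝ} {β : ℝ → ℝ} {ϑ b : ℝ}
    (hmem : ∀ s ∈ I, γ s ∈ quadric) (hβ : ∀ s ∈ I, HasDerivAt β b s)
    (hγ : ∀ s ∈ I, HasDerivAt γ
      (Real.cos ϑ • frame τ 0 (γ s) + (Real.sin ϑ * Real.sin (β s)) • frame τ 1 (γ s) +
        (Real.sin ϑ * Real.cos (β s)) • frame τ 2 (γ s)) s)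
    (hlt : b ^ 2 < 4 * aConst τ ϑ b) :
    ∃ A ∈ O₂4, A * J₁ = J₁ * A ∧
      ∀ s ∈ I, γ s = A.mulVec (modelCurve b (muConst τ ϑ b) (wConst τ ϑ b) s) := by
  set μ := muConst τ ϑ b with hμdef
  set d := τ⁻¹ * Real.cos ϑ + b / 2 with hd
  have hμ : 0 < μ := by
    rw [hμdef, muConst]
    have : 0 < Real.sqrt (4 * aConst τ ϑ b - b ^ 2) := Real.sqrt_pos.mpr (by linarith)
    positivity
  have hμ2 : μ ^ 2 = Real.sin ϑ ^ 2 - d ^ 2 := by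
    rw [hμdef, muConst, div_pow, Real.sq_sqrt (by linarith), four_aConst_sub hτ]
    ring
  have hw : wConst τ ϑ b = d / μ := by
    rw [wConst, ← hμdef, hd]
    field_simp
    ring
  set w := wConst τ ϑ b with hwdef
  have hwμ : w * μ = d := by rw [hw]; field_simp
  set x : ℝ → ℝ := fun s => Real.sin ϑ * Real.sin (β s) with hx
  set y : ℝ → ℝ := fun s => Real.sin ϑ * Real.cos (β s) with hy
  have hxy : ∀ s, x s ^ 2 + y s ^ 2 = μ ^ 2 + d ^ 2 := fun s => by
    have := Real.sin_sq_add_cos_sq (β s)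
    simp only [hx, hy]
    linear_combination Real.sin ϑ ^ 2 * this - hμ2
  have hx' : ∀ s ∈ I, HasDerivAt x (b * y s) s := fun s hs =>
    (((hβ s hs).sin).const_mul _).congr_deriv (by simp only [hy]; ring)
  have hy' : ∀ s ∈ I, HasDerivAt y (-b * x s) s := fun s hs =>
    (((hβ s hs).cos).const_mul _).congr_deriv (by simp only [hx]; ring)
  set c : ℝ → ℝ := fun s => Real.cos (b / 2 * s) with hc
  set e : ℝ → ℝ := fun s => Real.sin (b / 2 * s) with he
  have hce : ∀ s, c s ^ 2 + e s ^ 2 = 1 := fun s => Real.cos_sq_add_sin_sq _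
  have hc' : ∀ s, HasDerivAt c (-(b / 2) * e s) s := fun s =>
    (((hasDerivAt_id s).const_mul (b / 2)).cos).congr_deriv (by simp [he]; ring)
  have he' : ∀ s, HasDerivAt e (b / 2 * c s) s := fun s =>
    (((hasDerivAt_id s).const_mul (b / 2)).sin).congr_deriv (by simp [hc]; ring)
  -- The velocity is split as `v + (b/2) X₁ γ`, so that rotating by `e^{-ibs/2}` removes the second
  -- term: `G = e^{-ibs/2} γ`, `H = μ⁻¹ e^{-ibs/2} v`.
  set v : ℝ → Fin 4 → ℝ := fun s i => -d * X₁ (γ s) i + x s * X₂ (γ s) i + y s * X₃ (γ s) i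
    with hv
  set G : ℝ → Fin 4 → ℝ := fun s i => c s * γ s i - e s * X₁ (γ s) i with hG
  set H : ℝ → Fin 4 → ℝ := fun s i => μ⁻¹ * (c s * v s i - e s * X₁ (v s) i) with hH
  have hγ' : ∀ s ∈ I, ∀ i, HasDerivAt (fun u => γ u i) (v s i + b / 2 * X₁ (γ s) i) s := by
    intro s hs i
    refine (hasDerivAt_pi.mp (hγ s hs) i).congr_deriv ?_
    simp [frame, hv, hx, hy, hd]
    ring
  have hGder : ∀ i, ∀ s ∈ I, HasDerivAt (fun u => G u i) (μ * H s i) s := by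
    intro i s hs
    have g0 := hγ' s hs 0
    have g1 := hγ' s hs 1
    have g2 := hγ' s hs 2
    have g3 := hγ' s hs 3
    fin_cases i
    · refine (((hc' s).mul g0).sub ((he' s).mul g1.neg)).congr_deriv ?_
      simp [hH, X₁]; field_simp; ring
    · refine (((hc' s).mul g1).sub ((he' s).mul g0)).congr_deriv ?_
      simp [hH, X₁]; field_simp; ring
    · refine (((hc' s).mul g2).sub ((he' s).mul g3.neg)).congr_deriv ?_
      simp [hH, X₁]; field_simp; ring
    · refine (((hc' s).mul g3).sub ((he' s).mul g2)).congr_deriv ?_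
      simp [hH, X₁]; field_simp; ring
  -- The rotation of `(x, y)` with speed `b` and `x² + y² - d² = μ²` make the derivative of `v`
  -- collapse to this form, which yields `H' = μG`.
  have hvder : ∀ s ∈ I, ∀ i, HasDerivAt (fun u => v u i)
      (μ ^ 2 * γ s i + b / 2 * X₁ (v s) i) s := by
    intro s hs i
    have g0 := hγ' s hs 0
    have g1 := hγ' s hs 1
    have g2 := hγ' s hs 2
    have g3 := hγ' s hs 3
    have a := hx' s hs
    have a' := hy' s hs
    have hq := hxy s
    fin_cases i
    · refine (((g1.neg.const_mul (-d)).add (a.mul g3)).add (a'.mul g2)).congr_deriv ?_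
      simp [hv, X₁, X₂, X₃]
      linear_combination γ s 0 * hq
    · refine (((g0.const_mul (-d)).add (a.mul g2)).add (a'.mul g3.neg)).congr_deriv ?_
      simp [hv, X₁, X₂, X₃]
      linear_combination γ s 1 * hq
    · refine (((g3.neg.const_mul (-d)).add (a.mul g1)).add (a'.mul g0)).congr_deriv ?_
      simp [hv, X₁, X₂, X₃]
      linear_combination γ s 2 * hq
    · refine (((g2.const_mul (-d)).add (a.mul g0)).add (a'.mul g1.neg)).congr_deriv ?_
      simp [hv, X₁, X₂, X₃]
      linear_combination γ s 3 * hq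
  have hHder : ∀ i, ∀ s ∈ I, HasDerivAt (fun u => H u i) (μ * G s i) s := by
    intro i s hs
    have g0 := hvder s hs 0
    have g1 := hvder s hs 1
    have g2 := hvder s hs 2
    have g3 := hvder s hs 3
    fin_cases i
    · refine ((((hc' s).mul g0).sub ((he' s).mul g1.neg)).const_mul μ⁻¹).congr_deriv ?_
      simp [hG, X₁]; field_simp; ring
    · refine ((((hc' s).mul g1).sub ((he' s).mul g0)).const_mul μ⁻¹).congr_deriv ?_
      simp [hG, X₁]; field_simp; ring
    · refine ((((hc' s).mul g2).sub ((he' s).mul g3.neg)).const_mul μ⁻¹).congr_deriv ?_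
      simp [hG, X₁]; field_simp; ring
    · refine ((((hc' s).mul g3).sub ((he' s).mul g2)).const_mul μ⁻¹).congr_deriv ?_
      simp [hG, X₁]; field_simp; ring
  obtain ⟨s₀, hs₀⟩ := hne
  have hN : ip (γ s₀) (γ s₀) = 1 := hmem s₀ hs₀
  have hce₀ := hce s₀
  have rot : ∀ u v : Fin 4 → ℝ, ip (fun i => c s₀ * u i - e s₀ * X₁ u i)
      (fun i => c s₀ * v i - e s₀ * X₁ v i) = ip u v := fun u v => by
    simp only [ip, X₁, Matrix.cons_val]
    linear_combination (u 0 * v 0 + u 1 * v 1 - u 2 * v 2 - u 3 * v 3) * hce₀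
  have hGG : ip (G s₀) (G s₀) = 1 := (rot _ _).trans hN
  have hHs : H s₀ = fun i => μ⁻¹ * (c s₀ * v s₀ i - e s₀ * X₁ (v s₀) i) := rfl
  have hGH : ip (G s₀) (H s₀) = 0 := by
    have h1 : ip (G s₀) (H s₀) = μ⁻¹ * ip (γ s₀) (v s₀) := by
      rw [← rot (γ s₀), hHs]; simp only [ip, hG]; ring
    rw [h1]
    simp [ip, hv, X₁, X₂, X₃]
    right; ring
  have hHH : ip (H s₀) (H s₀) = -1 := by
    have h1 : ip (H s₀) (H s₀) = (μ ^ 2)⁻¹ * ip (v s₀) (v s₀) := by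
      rw [← rot (v s₀), hHs]; simp only [ip]; ring
    have h2 : ip (v s₀) (v s₀) = -μ ^ 2 * ip (γ s₀) (γ s₀) := by
      simp only [ip, hv, X₁, X₂, X₃, Matrix.cons_val]
      linear_combination -(γ s₀ 0 * γ s₀ 0 + γ s₀ 1 * γ s₀ 1 - γ s₀ 2 * γ s₀ 2
        - γ s₀ 3 * γ s₀ 3) * hxy s₀
    rw [h1, h2, hN]
    field_simp
  have hXGH : ip (X₁ (G s₀)) (H s₀) = -w := by
    have h0 : X₁ (G s₀) = fun i => c s₀ * X₁ (γ s₀) i - e s₀ * X₁ (X₁ (γ s₀)) i := by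
      ext i
      fin_cases i <;> simp [hG, X₁] <;> ring
    have h1 : ip (X₁ (G s₀)) (H s₀) = μ⁻¹ * ip (X₁ (γ s₀)) (v s₀) := by
      rw [← rot (X₁ (γ s₀)), h0, hHs]; simp only [ip]; ring
    have h2 : ip (X₁ (γ s₀)) (v s₀) = -d * ip (γ s₀) (γ s₀) := by
      simp [ip, hv, X₁, X₂, X₃]
      ring
    rw [h1, h2, hN, ← hwμ]
    field_simp
  set C := Real.cosh (μ * s₀) with hC
  set S := Real.sinh (μ * s₀) with hS
  have hCS : C ^ 2 - S ^ 2 = 1 := Real.cosh_sq_sub_sinh_sq _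
  set r := Real.sqrt (1 + w ^ 2) with hr
  have hr0 : 0 < r := Real.sqrt_pos.mpr (by positivity)
  have hr2 : r ^ 2 = 1 + w ^ 2 := Real.sq_sqrt (by positivity)
  -- `U` and `V` are the values at parameter `0` of the solution `(G, H)`, continued outside `I` if
  -- necessary. `F` is `V` made orthogonal to `X₁ U` and normalised.
  set U : Fin 4 → ℝ := fun i => C * G s₀ i - S * H s₀ i with hU
  set V : Fin 4 → ℝ := fun i => C * H s₀ i - S * G s₀ i with hV
  set F : Fin 4 → ℝ := fun i => r⁻¹ * (V i + w * X₁ U i) with hF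
  have hUU : ip U U = 1 := by
    have : ip U U = C ^ 2 * ip (G s₀) (G s₀) + S ^ 2 * ip (H s₀) (H s₀)
        - 2 * C * S * ip (G s₀) (H s₀) := by simp only [ip, hU]; ring
    rw [this, hGG, hHH, hGH]; linear_combination hCS
  have hVV : ip V V = -1 := by
    have : ip V V = S ^ 2 * ip (G s₀) (G s₀) + C ^ 2 * ip (H s₀) (H s₀)
        - 2 * C * S * ip (G s₀) (H s₀) := by simp only [ip, hV]; ring
    rw [this, hGG, hHH, hGH]; linear_combination -hCS
  have hUV : ip U V = 0 := by
    have : ip U V = -(C * S) * ip (G s₀) (G s₀) - C * S * ip (H s₀) (H s₀)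
        + (C ^ 2 + S ^ 2) * ip (G s₀) (H s₀) := by simp only [ip, hU, hV]; ring
    rw [this, hGG, hHH, hGH]; ring
  have hXUV : ip (X₁ U) V = -w := by
    have : ip (X₁ U) V = (C ^ 2 - S ^ 2) * ip (X₁ (G s₀)) (H s₀) := by
      simp only [ip, hU, hV, X₁, Matrix.cons_val]; ring
    rw [this, hCS, hXGH, one_mul]
  have hUX : ip U (X₁ U) = 0 := by simp [ip, X₁]; ring
  have hXX : ip (X₁ U) (X₁ U) = 1 := by rw [← hUU]; simp [ip, X₁]; ring
  refine ⟨frameMatrix U F, frameMatrix_mem hUU ?_ ?_ ?_, frameMatrix_commute U F, ?_⟩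
  · have : ip F F = (r ^ 2)⁻¹ *
        (ip V V + 2 * w * ip (X₁ U) V + w ^ 2 * ip (X₁ U) (X₁ U)) := by
      simp only [ip, hF]; ring
    rw [this, hVV, hXUV, hXX, hr2]
    field_simp
    ring
  · have : ip U F = r⁻¹ * (ip U V + w * ip U (X₁ U)) := by simp only [ip, hF]; ring
    rw [this, hUV, hUX]; ring
  · have : ip (X₁ U) F = r⁻¹ * (ip (X₁ U) V + w * ip (X₁ U) (X₁ U)) := by
      simp only [ip, hF]; ring
    rw [this, hXUV, hXX]; ring
  · intro s hs
    have hGs : ∀ i, G s i = Real.cosh (μ * s) * U i + Real.sinh (μ * s) * V i := fun i =>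
      eq_of_hasDerivAt_pair hI hI' (hGder i) (hHder i) hs₀ s hs
    have hrF : ∀ i, F i * r = V i + w * X₁ U i := fun i => by
      simp only [hF]; field_simp
    have hγG : ∀ i, γ s i = c s * G s i + e s * X₁ (G s) i := fun i => by
      fin_cases i <;> simp [hG, X₁]
      · linear_combination -γ s 0 * hce s
      · linear_combination -γ s 1 * hce s
      · linear_combination -γ s 2 * hce s
      · linear_combination -γ s 3 * hce s
    have r0 := hrF 0
    have r1 := hrF 1
    have r2 := hrF 2
    have r3 := hrF 3
    simp only [X₁, Matrix.cons_val] at r0 r1 r2 r3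
    ext i
    rw [hγG]
    fin_cases i <;>
      simp only [frameMatrix, modelCurve, Matrix.mulVec, dotProduct, Fin.sum_univ_four,
        Matrix.of_apply, Fin.zero_eta, Fin.mk_one, Fin.reduceFinMk, X₁, Matrix.cons_val, hGs,
        hc, he, ← hr]
    · linear_combination Real.sinh (μ * s) * (-Real.cos (b / 2 * s) * r0 +
        Real.sin (b / 2 * s) * r1)
    · linear_combination Real.sinh (μ * s) * (-Real.cos (b / 2 * s) * r1 -
        Real.sin (b / 2 * s) * r0)
    · linear_combination Real.sinh (μ * s) * (-Real.cos (b / 2 * s) * r2 +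
        Real.sin (b / 2 * s) * r3)
    · linear_combination Real.sinh (μ * s) * (-Real.cos (b / 2 * s) * r3 -
        Real.sin (b / 2 * s) * r2)

/-! ### From the curve to its component system -/

/-- The components of the covariant derivative along a curve with velocity components `t` of
the field with components `v`. -/
def covComp (τ : ℝ) (t v : ℝ → Fin 3 → ℝ) (s : ℝ) (k : Fin 3) : ℝ :=
  deriv (fun u => v u k) s + connPart τ (t s) (v s) k

lemma contDiffOn_covComp {τ : ℝ} {I : Set ℝ} (hI : IsOpen I) {t v : ℝ → Fin 3 → ℝ}
    (ht : ∀ k, ContDiffOn ℝ ∞ (fun u => t u k) I) (hv : ∀ k, ContDiffOn ℝ ∞ (fun u => v u k) I)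
    (k : Fin 3) : ContDiffOn ℝ ∞ (fun s => covComp τ t v s k) I := by
  refine ((hv k).deriv_of_isOpen hI (by simp)).add ?_
  have t0 := ht 0
  have t1 := ht 1
  have t2 := ht 2
  have v0 := hv 0
  have v1 := hv 1
  have v2 := hv 2
  fin_cases k <;> simp only [connPart, Fin.zero_eta, Fin.mk_one, Fin.reduceFinMk,
    Matrix.cons_val] <;> fun_prop

lemma hasDerivAt_of_contDiffOn {I : Set ℝ} (hI : IsOpen I) {E : Type*} [NormedAddCommGroup E]
    [NormedSpace ℝ E] {f : ℝ → E} (hf : ContDiffOn ℝ ∞ f I) {s : ℝ} (hs : s ∈ I) :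
    HasDerivAt f (deriv f s) s :=
  ((hf.differentiableOn (by simp)).differentiableAt (hI.mem_nhds hs)).hasDerivAt

lemma isCovDeriv_covComp {τ : ℝ} {I : Set ℝ} (hI : IsOpen I) {t v : ℝ → Fin 3 → ℝ}
    (hv : ∀ k, ContDiffOn ℝ ∞ (fun u => v u k) I) : IsCovDeriv τ I t v (covComp τ t v) :=
  fun _ hs k => (hasDerivAt_of_contDiffOn hI (hv k) hs).congr_deriv (by simp [covComp])

lemma metric_sum_frame (τ : ℝ) (p v : Fin 4 → ℝ) (c : Fin 3 → ℝ) :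
    metric τ p v (∑ i, c i • frame τ i p) = ∑ i, c i * comp τ p v i := by
  simp only [comp, metric, ip, Fin.sum_univ_three, Pi.add_apply, Pi.smul_apply, smul_eq_mul]
  ring

lemma ip_deriv_eq_zero {I : Set ℝ} (hI : IsOpen I) {γ : ℝ → Fin 4 → ℝ}
    (hmem : ∀ s ∈ I, γ s ∈ quadric) {s : ℝ} (hs : s ∈ I) {v : Fin 4 → ℝ}
    (hv : HasDerivAt γ v s) : ip (γ s) v = 0 := by
  have g := hasDerivAt_pi.mp hv
  have h := ((((g 0).mul (g 0)).add ((g 1).mul (g 1))).sub ((g 2).mul (g 2))).sub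
    ((g 3).mul (g 3))
  have := derivAt_eq_zero_of_eventually_const h (c := 1) (by
    filter_upwards [hI.mem_nhds hs] with u hu using hmem u hu)
  simp only [ip]
  linarith

/-- The velocity components of a proper biharmonic curve. -/
theorem exists_angle_system {τ : ℝ} (hτ : τ ≠ 0) {I : Set ℝ} (hI : IsOpen I)
    (hI' : I.OrdConnected) {γ : ℝ → Fin 4 → ℝ} (hγ : IsArcLengthCurve τ I γ)
    (hbi : IsProperBiharmonic τ I γ) :
    ∃ (t : ℝ → Fin 3 → ℝ) (c b : ℝ), c ^ 2 < 1 ∧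
      (b + (2 * τ⁻¹ + 2 * τ) * c) ^ 2 - 2 * τ * (b + (2 * τ⁻¹ + 2 * τ) * c) * c +
        (4 + 4 * τ ^ 2) * (1 - c ^ 2) = 0 ∧
      ∀ s ∈ I, deriv γ s = ∑ i, t s i • frame τ i (γ s) ∧
        t s 0 ^ 2 + t s 1 ^ 2 + t s 2 ^ 2 = 1 ∧ t s 0 = c ∧
        HasDerivAt (fun u => t u 1) (b * t s 2) s ∧
        HasDerivAt (fun u => t u 2) (-b * t s 1) s := by
  set t : ℝ → Fin 3 → ℝ := fun s i => comp τ (γ s) (deriv γ s) i with htdef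
  have hder : ∀ s ∈ I, HasDerivAt γ (deriv γ s) s := fun s hs =>
    hasDerivAt_of_contDiffOn hI hγ.smooth hs
  have hT : ∀ s ∈ I, deriv γ s = ∑ i, t s i • frame τ i (γ s) := fun s hs =>
    (sum_comp_frame hτ (hγ.mem_quadric s hs)
      (ip_deriv_eq_zero hI hγ.mem_quadric hs (hder s hs))).symm
  have htt : ∀ s ∈ I, dot (t s) (t s) = 1 := by
    intro s hs
    have h := hγ.unit_speed s hs
    nth_rewrite 2 [hT s hs] at h
    rw [metric_sum_frame, Fin.sum_univ_three] at h
    exact h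
  have hts : ∀ k, ContDiffOn ℝ ∞ (fun u => t u k) I := by
    intro k
    have g : ∀ i, ContDiffOn ℝ ∞ (fun u => γ u i) I := contDiffOn_pi.mp hγ.smooth
    have g' : ∀ i, ContDiffOn ℝ ∞ (fun u => deriv γ u i) I :=
      contDiffOn_pi.mp (hγ.smooth.deriv_of_isOpen hI (by simp))
    have g0 := g 0
    have g1 := g 1
    have g2 := g 2
    have g3 := g 3
    have g0' := g' 0
    have g1' := g' 1
    have g2' := g' 2
    have g3' := g' 3
    fin_cases k <;> simp only [htdef, comp, metric, ip, frame, X₁, X₂, X₃, Fin.zero_eta,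
      Fin.mk_one, Fin.reduceFinMk, Matrix.cons_val, Pi.smul_apply, smul_eq_mul] <;> fun_prop
  set p := covComp τ t t with hpdef
  have hps := contDiffOn_covComp (τ := τ) hI hts hts
  set q := covComp τ t p with hqdef
  have hqs := contDiffOn_covComp (τ := τ) hI hts hps
  have hP : ∀ s ∈ I, tension τ γ s = ∑ i, p s i • frame τ i (γ s) := fun s hs =>
    covAlong_eq hτ hI hγ.mem_quadric hT hT hs
  have hQ : ∀ s ∈ I, covAlong τ γ (tension τ γ) s = ∑ i, q s i • frame τ i (γ s) :=
    fun s hs => covAlong_eq hτ hI hγ.mem_quadric hT hP hs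
  have ht' : IsCovDeriv τ I t t p := isCovDeriv_covComp hI hts
  have hp' : IsCovDeriv τ I t p q := isCovDeriv_covComp hI hps
  have htp : ∀ s ∈ I, dot (t s) (p s) = 0 := by
    intro s hs
    have := derivAt_eq_zero_of_eventually_const (ht'.dot ht' hs) (by
      filter_upwards [hI.mem_nhds hs] with u hu using htt u hu)
    simp only [dot] at this ⊢
    linarith
  have hR : ∀ s ∈ I, covComp τ t q s = curvComp τ (t s) (p s) := by
    intro s hs
    have h := hbi.biharmonic s hs
    have e1 := htt s hs
    rw [bitension, covAlong_eq hτ hI hγ.mem_quadric hT hQ hs, hT s hs, hP s hs,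
      curv_eq hτ (hγ.mem_quadric s hs) _ _ (by rw [← e1, dot]; ring) (htp s hs),
      sub_eq_zero] at h
    funext k
    have hk := congrArg (fun v => comp τ (γ s) v k) h
    simp only [comp_sum_frame_of_mem hτ _ (hγ.mem_quadric s hs)] at hk
    exact hk
  have hq' : IsCovDeriv τ I t q fun s => curvComp τ (t s) (p s) := fun s hs k => by
    have := isCovDeriv_covComp (τ := τ) (t := t) hI hqs s hs k
    rw [hR s hs] at this
    exact this
  have hne : ∃ s ∈ I, p s ≠ 0 := by
    by_contra! hall
    refine hbi.not_geodesic fun s hs => ?_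
    rw [hP s hs, hall s hs]
    simp
  obtain ⟨c, b, hc, hroot, hsys⟩ := biharmonic_system hτ hI hI' ht' hp' hq' htt hne
  refine ⟨t, c, b, hc, hroot, fun s hs => ⟨hT s hs, ?_, hsys s hs⟩⟩
  rw [← htt s hs, dot]
  ring

/-- A solution of `t₁' = b t₂`, `t₂' = -b t₁` of norm `r` is a uniform rotation. -/
lemma exists_phase {I : Set ℝ} (hI : IsOpen I) (hI' : I.OrdConnected) {x y : ℝ → ℝ} {b r : ℝ}
    (hne : I.Nonempty) (hr : 0 < r) (hx : ∀ s ∈ I, HasDerivAt x (b * y s) s)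
    (hy : ∀ s ∈ I, HasDerivAt y (-b * x s) s) (hxy : ∀ s ∈ I, x s ^ 2 + y s ^ 2 = r ^ 2) :
    ∃ φ : ℝ, ∀ s ∈ I, x s = r * Real.sin (b * s + φ) ∧ y s = r * Real.cos (b * s + φ) := by
  have hc : ∀ s, HasDerivAt (fun u => Real.cos (b * u)) (-b * Real.sin (b * s)) s := fun s =>
    (((hasDerivAt_id s).const_mul b).cos).congr_deriv (by simp; ring)
  have hs : ∀ s, HasDerivAt (fun u => Real.sin (b * u)) (b * Real.cos (b * s)) s := fun s =>
    (((hasDerivAt_id s).const_mul b).sin).congr_deriv (by simp; ring)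
  obtain ⟨u, hu⟩ := exists_const_of_hasDerivAt_zero hI hI'
    (f := fun s => x s * Real.cos (b * s) - y s * Real.sin (b * s)) fun s hsI =>
    (((hx s hsI).mul (hc s)).sub ((hy s hsI).mul (hs s))).congr_deriv (by ring)
  obtain ⟨v, hv⟩ := exists_const_of_hasDerivAt_zero hI hI'
    (f := fun s => x s * Real.sin (b * s) + y s * Real.cos (b * s)) fun s hsI =>
    (((hx s hsI).mul (hs s)).add ((hy s hsI).mul (hc s))).congr_deriv (by ring)
  obtain ⟨s₀, hs₀⟩ := hne
  have huv : u ^ 2 + v ^ 2 = r ^ 2 := by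
    rw [← hu s₀ hs₀, ← hv s₀ hs₀, ← hxy s₀ hs₀]
    linear_combination (x s₀ ^ 2 + y s₀ ^ 2) * Real.sin_sq_add_cos_sq (b * s₀)
  -- The conserved pair is `(u, v) = (r sin φ, r cos φ)`, so the phase is the argument of `v + iu`.
  set z : ℂ := ⟨v, u⟩ with hz
  have hnorm : ‖z‖ = r := by
    rw [Complex.norm_eq_sqrt_sq_add_sq, add_comm, huv, Real.sqrt_sq hr.le]
  have h1 : r * Real.cos z.arg = v := by rw [← hnorm, Complex.norm_mul_cos_arg]
  have h2 : r * Real.sin z.arg = u := by rw [← hnorm, Complex.norm_mul_sin_arg]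
  refine ⟨z.arg, fun s hsI => ?_⟩
  have e1 := hu s hsI
  have e2 := hv s hsI
  have e3 := Real.sin_sq_add_cos_sq (b * s)
  constructor
  · rw [Real.sin_add]
    linear_combination -x s * e3 + Real.cos (b * s) * e1 + Real.sin (b * s) * e2 -
      Real.sin (b * s) * h1 - Real.cos (b * s) * h2
  · rw [Real.cos_add]
    linear_combination -y s * e3 - Real.sin (b * s) * e1 + Real.cos (b * s) * e2 -
      Real.cos (b * s) * h1 + Real.sin (b * s) * h2

end

end SL2Tau

/-! ### Assembly of the theorem -/

open SL2Tau in
theorem mainTheorem7 (τ : ℝ) (hτ : 0 < τ) (I : Set ℝ) (hI : IsOpen I) (hI' : I.OrdConnected)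
    (γ : ℝ → Fin 4 → ℝ) (hγ : SL2Tau.IsArcLengthCurve τ I γ)
    (hbi : SL2Tau.IsProperBiharmonic τ I γ) :
    (∃ ϑ ∈ Set.Ioo 0 Real.pi, ∃ β : ℝ → ℝ, SL2Tau.HasAngles τ I γ ϑ β) ∧
    ∀ ϑ ∈ Set.Ioo 0 Real.pi, ∀ β : ℝ → ℝ, SL2Tau.HasAngles τ I γ ϑ β →
      ∃ b : ℝ, (∀ s ∈ I, HasDerivAt β b s) ∧
        (b ^ 2 < 4 * SL2Tau.aConst τ ϑ b →
          (ϑ ≤ Real.pi / 2 →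
            b = -τ⁻¹ * (2 + τ ^ 2) * Real.cos ϑ +
              Real.sqrt ((4 + 5 * τ ^ 2) * Real.cos ϑ ^ 2 - 4 * (1 + τ ^ 2))) ∧
          (Real.pi / 2 < ϑ →
            b = -τ⁻¹ * (2 + τ ^ 2) * Real.cos ϑ -
              Real.sqrt ((4 + 5 * τ ^ 2) * Real.cos ϑ ^ 2 - 4 * (1 + τ ^ 2))) ∧
          (2 + τ ^ 2) ^ 2 / (4 + 5 * τ ^ 2 + τ ^ 4) < Real.cos ϑ ^ 2 ∧
          Real.cos ϑ ^ 2 < 1 ∧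
          ∃ A ∈ SL2Tau.O₂4, A * SL2Tau.J₁ = SL2Tau.J₁ * A ∧
            ∀ s ∈ I, γ s = A.mulVec
              (SL2Tau.modelCurve b (SL2Tau.muConst τ ϑ b) (SL2Tau.wConst τ ϑ b) s)) := by
  have hne : I.Nonempty := by
    by_contra h
    rw [Set.not_nonempty_iff_eq_empty] at h
    exact hbi.not_geodesic (by simp [h])
  obtain ⟨t, c, b, hc, hroot, hsys⟩ := exists_angle_system hτ.ne' hI hI' hγ hbi
  refine ⟨?_, ?_⟩
  · have hc1 : -1 < c ∧ c < 1 := abs_lt.mp (sq_lt_one_iff_abs_lt_one c |>.mp hc)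
    have hϑ : Real.arccos c ∈ Set.Ioo 0 Real.pi := by
      refine ⟨Real.arccos_pos.mpr hc1.2, lt_of_le_of_ne (Real.arccos_le_pi c) fun h => ?_⟩
      rw [Real.arccos_eq_pi] at h
      linarith [hc1.1]
    have hcos : Real.cos (Real.arccos c) = c := Real.cos_arccos hc1.1.le hc1.2.le
    obtain ⟨φ, hφ⟩ := exists_phase hI hI' hne (Real.sin_pos_of_mem_Ioo hϑ)
      (fun s hs => (hsys s hs).2.2.2.1) (fun s hs => (hsys s hs).2.2.2.2) fun s hs => by
        obtain ⟨-, h1, h2, -⟩ := hsys s hs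
        rw [h2] at h1
        rw [Real.sin_sq, hcos]
        linarith
    refine ⟨Real.arccos c, hϑ, fun s => b * s + φ, by fun_prop, fun s hs => ?_⟩
    obtain ⟨h0, -, h2, -⟩ := hsys s hs
    rw [h0, Fin.sum_univ_three, h2, (hφ s hs).1, (hφ s hs).2, hcos]
  · intro ϑ hϑ β hβ
    have hsin : 0 < Real.sin ϑ := Real.sin_pos_of_mem_Ioo hϑ
    -- Frame components on the quadric are unique, so every admissible pair `ϑ, β` is governed by
    -- the same constants `c` and `b`.
    have hcomp : ∀ s ∈ I, ∀ i, t s i =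
        (![Real.cos ϑ, Real.sin ϑ * Real.sin (β s), Real.sin ϑ * Real.cos (β s)] :
          Fin 3 → ℝ) i := by
      intro s hs i
      have hq := hγ.mem_quadric s hs
      rw [← comp_sum_frame_of_mem hτ.ne' (t s) hq i, ← (hsys s hs).1, hβ.tangent s hs,
        ← comp_sum_frame_of_mem hτ.ne' (![Real.cos ϑ, Real.sin ϑ * Real.sin (β s),
          Real.sin ϑ * Real.cos (β s)]) hq i, Fin.sum_univ_three]
      simp
    have hcϑ : c = Real.cos ϑ := by
      obtain ⟨s, hs⟩ := hne
      rw [← (hsys s hs).2.2.1, hcomp s hs 0]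
      simp
    have hβ' : ∀ s ∈ I, HasDerivAt β b s := by
      intro s hs
      have hd := hasDerivAt_of_contDiffOn hI hβ.smooth hs
      have h1 : HasDerivAt (fun u => t u 1)
          (Real.sin ϑ * (Real.cos (β s) * deriv β s)) s := by
        refine ((hd.sin).const_mul (Real.sin ϑ)).congr_of_eventuallyEq ?_
        filter_upwards [hI.mem_nhds hs] with u hu
        simp [hcomp u hu]
      have h2 : HasDerivAt (fun u => t u 2)
          (Real.sin ϑ * (-Real.sin (β s) * deriv β s)) s := by
        refine ((hd.cos).const_mul (Real.sin ϑ)).congr_of_eventuallyEq ?_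
        filter_upwards [hI.mem_nhds hs] with u hu
        simp [hcomp u hu]
      have e1 := h1.unique (hsys s hs).2.2.2.1
      have e2 := h2.unique (hsys s hs).2.2.2.2
      rw [hcomp s hs] at e1 e2
      simp only [Matrix.cons_val] at e1 e2
      have e : deriv β s = b := mul_left_cancel₀ hsin.ne' (by
        linear_combination Real.cos (β s) * e1 - Real.sin (β s) * e2 +
          Real.sin ϑ * (b - deriv β s) * Real.sin_sq_add_cos_sq (β s))
      rw [← e]
      exact hd
    refine ⟨b, hβ', fun hlt => ?_⟩
    -- The left side is the square of `b + 2τ⁻¹c`, written in the variable `x` of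
    -- `root_eq_of_nonneg`.
    have hlt' : (b + (2 * τ⁻¹ + 2 * τ) * c - 2 * τ * c) ^ 2 < 4 * (1 - c ^ 2) := by
      have h := four_aConst_sub hτ.ne' ϑ b
      rw [Real.sin_sq, ← hcϑ] at h
      linarith
    have hx : -τ⁻¹ * (2 + τ ^ 2) * c = τ * c - (2 * τ⁻¹ + 2 * τ) * c := by
      field_simp
      ring
    refine ⟨fun hle => ?_, fun hgt => ?_, ?_, hcϑ ▸ hc, ?_⟩
    · have hc0 : 0 ≤ c := hcϑ ▸ Real.cos_nonneg_of_mem_Icc ⟨by linarith [hϑ.1], hle⟩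
      rw [← hcϑ, hx]
      linarith [(root_eq_of_nonneg hτ hc0 hroot hlt').1]
    · have hc0 : 0 ≤ -c := by
        rw [hcϑ, neg_nonneg]
        exact Real.cos_nonpos_of_pi_div_two_le_of_le hgt.le (by linarith [hϑ.2])
      -- Replacing `(c, x)` by `(-c, -x)` preserves the quadratic and the inequality; this
      -- corresponds to reversing the parameter and flips the sign of the square root.
      have h := (root_eq_of_nonneg (x := -(b + (2 * τ⁻¹ + 2 * τ) * c)) hτ hc0
        (by linear_combination hroot) (by linarith)).1
      rw [neg_sq] at h
      rw [← hcϑ, hx]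
      linarith
    · rw [← hcϑ]
      rcases le_total 0 c with hc0 | hc0
      · exact (root_eq_of_nonneg hτ hc0 hroot hlt').2
      · have h := (root_eq_of_nonneg (x := -(b + (2 * τ⁻¹ + 2 * τ) * c)) (c := -c) hτ
          (by linarith) (by linear_combination hroot) (by linarith)).2
        rwa [neg_sq] at h
    · refine exists_congruence hτ.ne' hI hI' hne hγ.mem_quadric hβ' (fun s hs => ?_) hlt
      rw [← hβ.tangent s hs]
      exact hasDerivAt_of_contDiffOn hI hγ.smooth hs
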